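/- Let $\mathbb T=\mathbb R/2\pi\mathbb Z$ and, for $h\in L^1(\mathbb T)$ and $k\in\mathbb Z$, let $\widehat h(k)=\frac1{2\pi}\int_0^{2\pi}h(\theta)e^{-ik\theta}\,d\theta$. For an integer $N\ge 0$ let $T_N(h)$ be the $(N+1)\times(N+1)$ Toeplitz matrix with entries $(T_N(h))_{k+1,l+1}=\widehat h(l-k)$, $0\le k,l\le N$. Let $0<\alpha_1<\tfrac12$ and $-\tfrac12<\alpha_2<0$, and let $c_1,c_2:\mathbb T\to\mathbb R$ be continuous, strictly positive functions with $\sum_{k\in\mathbb Z}|k|^{3/2}\,|\widehat{c_i}(k)|<\infty$ for $i=1,2$. Put $f_i(\theta)=|1-e^{i\theta}|^{2\alpha_i}c_i(\theta)$ for $i=1,2$ and assume that $f_1$ and $f_2$ are even. Then $f_1/f_2\in L^\infty(\mathbb T)$, every matrix $T_N(f_2)$ is invertible, and the $N+1$ eigenvalues of $T_N(f_1)\,T_N(f_2)^{-1}$, counted with multiplicity, are real. If $\mu_{\min}^{(N)}$ and $\mu_{\max}^{(N)}$ denote the smallest and the largest of them, then $$\lim_{N\to+\infty}\mu_{\min}^{(N)}=0,\qquad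 \lim_{N\to+\infty}\mu_{\max}^{(N)}=\left\|\frac{f_1}{f_2}\right\|_{\infty}.$$ -/

import Mathlib

open MeasureTheory Filter Topology

noncomputable section

/-- The torus `𝕋 = ℝ / 2πℤ`, on which functions of the angle `θ` are defined. -/
abbrev Torus : Type := AddCircle (2 * Real.pi)

/-- The period `2π` is positive. -/
instance torusPeriodPos : Fact (0 < 2 * Real.pi) := ⟨Real.two_pi_pos⟩

/-- The normalized Lebesgue measure `dθ / 2π` on the torus. -/
abbrev torusMeasure : Measure Torus := AddCircle.haarAddCircle

/-- The function `χ(θ) = e^{iθ}`. -/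
def chi (θ : Torus) : ℂ := (AddCircle.toCircle θ : ℂ)

/-- Membership in `A(𝕋, ν)`: `h ∈ L²(𝕋)` and `∑_{k ∈ ℤ} |k|^ν |ĥ(k)| < ∞`. -/
def MemA (ν : ℝ) (h : Torus → ℂ) : Prop :=
  MemLp h 2 torusMeasure ∧ Summable fun k : ℤ => |(k : ℝ)| ^ ν * ‖fourierCoeff h k‖

/-- A regular factor: a strictly positive function of `A(𝕋, 3/2)`, given by its
continuous representative. -/
structure IsRegularFactor (c : Torus → ℝ) : Prop where
  continuous : Continuous c
  pos : ∀ θ, 0 < c θ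
  memA : MemA (3 / 2) fun θ => (c θ : ℂ)

/-- The symbol `|1 - χ|^{2α} c`. -/
def symbol (α : ℝ) (c : Torus → ℝ) (θ : Torus) : ℝ := ‖1 - chi θ‖ ^ (2 * α) * c θ

/-- The Toeplitz matrix `T_N(f)`, of size `N + 1`, whose entry of index `(k, l)`,
`0 ≤ k, l ≤ N`, is the Fourier coefficient of `f` of order `l - k`. -/
def toeplitz (N : ℕ) (f : Torus → ℝ) : Matrix (Fin (N + 1)) (Fin (N + 1)) ℂ :=
  Matrix.of fun k l => fourierCoeff (fun θ => (f θ : ℂ)) ((l : ℤ) - (k : ℤ))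

/-- The eigenvalues of `A`, counted with algebraic multiplicity, are all real and `μ` lists
them in increasing order. -/
def IsOrderedSpectrum {n : ℕ} (A : Matrix (Fin n) (Fin n) ℂ) (μ : Fin n → ℝ) : Prop :=
  Monotone μ ∧ A.charpoly.roots = (Finset.univ : Finset (Fin n)).val.map fun i => (μ i : ℂ)

end

/-!
The eigenvalues of `T_N(f₁) T_N(f₂)⁻¹` are governed by a generalized Rayleigh quotient. For a vector
`x` let `p = ∑ x_l e^{-ilθ}`; then `x* T_N(h) x = ∫ h |p|²`. In particular `T_N(f₂)` is positive
definite, since `f₂ > 0` almost everywhere. Writing `T_N(f₂)⁻¹ = M* M`, the matrix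
`T_N(f₁) T_N(f₂)⁻¹` has the characteristic polynomial of the Hermitian matrix `M T_N(f₁) M*`, so its
eigenvalues are real, and `t` is at most the smallest one exactly when
`T_N(f₁) - t T_N(f₂) = T_N(f₁ - t f₂)` is positive semidefinite; the largest one is handled in
the same way (`exists_isOrderedSpectrum_mul_inv`).

With `g = f₁ / f₂`, the symbol `f₁ - t f₂ = (g - t) f₂` has the sign of `g - t`. If `t ≤ min g`, its
Toeplitz matrices are positive semidefinite. If `g < t` somewhere, then `(g - t) f₂` is negative on
a nonempty open set, and its Toeplitz matrices of large size are not positive semidefinite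
(`eventually_not_posSemidef_toeplitz`): trigonometric polynomials are uniformly dense in the
continuous functions, and multiplying one by a power of `e^{iθ}` removes its positive frequencies without
changing its modulus. Hence the extreme eigenvalues converge to the minimum and the maximum of `g`.

Here `g` is a positive continuous function times `|1 - χ|^{2α₁ - 2α₂}`, and the exponent is
positive: `g` is continuous, its minimum `0` is attained at `θ = 0`, and its maximum is its
`L^∞` norm. The condition `α₂ > -1/2` makes `f₂` integrable.
-/

/-! ### Hermitian pencils -/

open scoped ComplexOrder in
theorem Matrix.IsHermitian.posSemidef_smul_sub_smul_one_iff {n : Type*} [Fintype n]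
    [DecidableEq n] {C : Matrix n n ℂ} (hC : C.IsHermitian) (s t : ℝ) :
    ((s : ℂ) • C - (t : ℂ) • (1 : Matrix n n ℂ)).PosSemidef ↔
      ∀ i, t ≤ s * hC.eigenvalues i := by
  set U := hC.eigenvectorUnitary
  have key : (s : ℂ) • C - (t : ℂ) • (1 : Matrix n n ℂ) =
      (U : Matrix n n ℂ) * Matrix.diagonal (fun i => ((s * hC.eigenvalues i - t : ℝ) : ℂ)) *
        star (U : Matrix n n ℂ) := by
    have h1 : C = (U : Matrix n n ℂ) * Matrix.diagonal (fun i => (hC.eigenvalues i : ℂ)) *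
        star (U : Matrix n n ℂ) := by
      conv_lhs => rw [hC.spectral_theorem, Unitary.conjStarAlgAut_apply]
      rfl
    have h2 : Matrix.diagonal (fun i => ((s * hC.eigenvalues i - t : ℝ) : ℂ)) =
        (s : ℂ) • Matrix.diagonal (fun i => (hC.eigenvalues i : ℂ)) -
          (t : ℂ) • (1 : Matrix n n ℂ) := by
      ext i j
      by_cases h : i = j <;> simp [h]
    rw [h2, mul_sub, sub_mul, mul_smul_comm, smul_mul_assoc, ← h1]
    simp
  rw [key, Matrix.IsUnit.posSemidef_star_right_conjugate_iff
    (Unitary.isUnit_coe), Matrix.posSemidef_diagonal_iff]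
  simp only [← Complex.ofReal_zero, Complex.real_le_real, sub_nonneg]

theorem Matrix.IsHermitian.exists_isOrderedSpectrum {N : ℕ}
    {C : Matrix (Fin (N + 1)) (Fin (N + 1)) ℂ} (hC : C.IsHermitian) :
    ∃ μ : Fin (N + 1) → ℝ, IsOrderedSpectrum C μ ∧
      (∀ t : ℝ, t ≤ μ 0 ↔ ∀ i, t ≤ hC.eigenvalues i) ∧
      (∀ t : ℝ, μ (Fin.last N) ≤ t ↔ ∀ i, hC.eigenvalues i ≤ t) := by
  set σ := Tuple.sort hC.eigenvalues
  have hmono : Monotone (hC.eigenvalues ∘ σ) := Tuple.monotone_sort _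
  refine ⟨hC.eigenvalues ∘ σ, ⟨hmono, ?_⟩, fun t => ⟨fun h i => ?_, fun h => h _⟩,
    fun t => ⟨fun h i => ?_, fun h => h _⟩⟩
  · rw [hC.roots_charpoly_eq_eigenvalues]
    have h : (Finset.univ : Finset (Fin (N + 1))).val.map σ = Finset.univ.val := by
      simp
    conv_lhs => rw [← h, Multiset.map_map]
    rfl
  · have := hmono (Fin.zero_le (σ.symm i))
    simp only [Function.comp_apply, Equiv.apply_symm_apply] at this
    exact h.trans this
  · have := hmono (Fin.le_last (σ.symm i))
    simp only [Function.comp_apply, Equiv.apply_symm_apply] at this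
    exact this.trans h

open scoped ComplexOrder in
/-- The extreme eigenvalues of `A B⁻¹`, for `A` Hermitian and `B` positive definite, are determined
by the Loewner order. The proof uses a factorization `B⁻¹ = M* M`: the matrix `A B⁻¹` has the
characteristic polynomial of `M A M*`, and congruence by `M` carries `A - t B` to
`M A M* - t`. -/
theorem exists_isOrderedSpectrum_mul_inv {N : ℕ}
    {A B : Matrix (Fin (N + 1)) (Fin (N + 1)) ℂ} (hA : A.IsHermitian) (hB : B.PosDef) :
    ∃ μ : Fin (N + 1) → ℝ, IsOrderedSpectrum (A * B⁻¹) μ ∧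
      (∀ t : ℝ, t ≤ μ 0 ↔ (A - (t : ℂ) • B).PosSemidef) ∧
      (∀ t : ℝ, μ (Fin.last N) ≤ t ↔ ((t : ℂ) • B - A).PosSemidef) := by
  obtain ⟨M, hM⟩ : ∃ M : Matrix (Fin (N + 1)) (Fin (N + 1)) ℂ, B⁻¹ = star M * M := by
    open scoped MatrixOrder in
    exact CStarAlgebra.nonneg_iff_eq_star_mul_self.mp hB.inv.posSemidef.nonneg
  have hMu : IsUnit M := by
    rw [Matrix.isUnit_iff_isUnit_det]
    have h := (Matrix.isUnit_iff_isUnit_det _).mp hB.inv.isUnit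
    rw [hM, Matrix.det_mul] at h
    exact isUnit_of_mul_isUnit_right h
  have hBdet : IsUnit B.det := (Matrix.isUnit_iff_isUnit_det _).mp hB.isUnit
  have hMB : M * B * star M = 1 := by
    have h1 : star M * (M * B) = 1 := by
      rw [← mul_assoc, ← hM, Matrix.nonsing_inv_mul _ hBdet]
    exact mul_eq_one_comm.mp h1
  have hC : (M * A * star M).IsHermitian := by
    rw [Matrix.star_eq_conjTranspose]
    exact Matrix.isHermitian_mul_mul_conjTranspose M hA
  obtain ⟨μ, ⟨hmono, hroots⟩, h0, h1⟩ := hC.exists_isOrderedSpectrum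
  refine ⟨μ, ⟨hmono, ?_⟩, fun t => ?_, fun t => ?_⟩
  · rw [← hroots, hM, ← mul_assoc, Matrix.charpoly_mul_comm, ← mul_assoc]
  · rw [h0, ← Matrix.IsUnit.posSemidef_star_right_conjugate_iff (x := A - (t : ℂ) • B) hMu,
      mul_sub, sub_mul, mul_smul_comm, smul_mul_assoc, hMB]
    simpa using (hC.posSemidef_smul_sub_smul_one_iff 1 t).symm
  · rw [h1, ← Matrix.IsUnit.posSemidef_star_right_conjugate_iff (x := (t : ℂ) • B - A) hMu,
      mul_sub, sub_mul, mul_smul_comm, smul_mul_assoc, hMB]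
    simpa [sub_eq_neg_add, add_comm] using (hC.posSemidef_smul_sub_smul_one_iff (-1) (-t)).symm

/-! ### Toeplitz matrices and trigonometric polynomials -/

noncomputable section

/-- The trigonometric polynomial `∑ x_l e^{-ilθ}`. The negative frequencies match the convention
that the entry of index `(k, l)` of a Toeplitz matrix is the coefficient of order `l - k`. -/
def antianalyticPoly {N : ℕ} (x : Fin (N + 1) → ℂ) : C(Torus, ℂ) :=
  ∑ l, x l • fourier (-(l : ℤ))

theorem toeplitz_isHermitian (N : ℕ) (h : Torus → ℝ) : (toeplitz N h).IsHermitian := by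
  ext k l
  simp only [Matrix.conjTranspose_apply, toeplitz, Matrix.of_apply, fourierCoeff, RCLike.star_def]
  rw [← integral_conj]
  congr 1
  ext θ
  rw [smul_eq_mul, smul_eq_mul, map_mul, ← fourier_neg, Complex.conj_ofReal]
  congr 3
  ring

theorem toeplitz_sub_smul (N : ℕ) {f g : Torus → ℝ} (hf : Integrable f torusMeasure)
    (hg : Integrable g torusMeasure) (s t : ℝ) :
    toeplitz N (fun θ => s * f θ - t * g θ) = (s : ℂ) • toeplitz N f - (t : ℂ) • toeplitz N g := by
  ext k l
  simp only [toeplitz, Matrix.of_apply, Matrix.sub_apply, Matrix.smul_apply, fourierCoeff,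
    smul_eq_mul]
  rw [← integral_const_mul, ← integral_const_mul, ← integral_sub]
  · congr 1
    ext θ
    push_cast
    ring
  · exact (hf.ofReal.fourier_smul (n := -((l : ℤ) - k))).const_mul _
  · exact (hg.ofReal.fourier_smul (n := -((l : ℤ) - k))).const_mul _

/-- The quadratic form of a Toeplitz matrix is integration against the symbol. -/
theorem star_dotProduct_toeplitz_mulVec {N : ℕ} {h : Torus → ℝ} (hh : Integrable h torusMeasure)
    (x : Fin (N + 1) → ℂ) :
    star x ⬝ᵥ (toeplitz N h).mulVec x =
      ((∫ θ, h θ * ‖antianalyticPoly x θ‖ ^ 2 ∂torusMeasure : ℝ) : ℂ) := by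
  have hpt : ∀ θ : Torus, ((h θ * ‖antianalyticPoly x θ‖ ^ 2 : ℝ) : ℂ) =
      ∑ k, ∑ l, (star (x k) * x l) *
        (fourier (-((l : ℤ) - (k : ℤ))) θ • (h θ : ℂ)) := by
    intro θ
    push_cast
    rw [← Complex.conj_mul']
    simp only [antianalyticPoly, ContinuousMap.coe_sum, Finset.sum_apply, ContinuousMap.smul_apply,
      map_sum, smul_eq_mul, map_mul, ← fourier_neg, neg_neg, Finset.sum_mul_sum]
    rw [Finset.mul_sum]
    refine Finset.sum_congr rfl fun k _ => ?_
    rw [Finset.mul_sum]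
    refine Finset.sum_congr rfl fun l _ => ?_
    rw [show -((l : ℤ) - (k : ℤ)) = (k : ℤ) + -(l : ℤ) by ring, fourier_add]
    simp only [RCLike.star_def]
    ring
  have hint : ∀ n : ℤ, Integrable (fun θ : Torus => fourier n θ • (h θ : ℂ)) torusMeasure :=
    fun n => Integrable.fourier_smul hh.ofReal n
  rw [← integral_complex_ofReal]
  simp_rw [hpt]
  rw [integral_finsetSum _ fun k _ => integrable_finsetSum _ fun l _ => (hint _).const_mul _]
  simp only [dotProduct, Matrix.mulVec, toeplitz, Matrix.of_apply, fourierCoeff, Pi.star_apply]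
  refine Finset.sum_congr rfl fun k _ => ?_
  rw [integral_finsetSum _ fun l _ => (hint _).const_mul _, Finset.mul_sum]
  refine Finset.sum_congr rfl fun l _ => ?_
  rw [integral_const_mul]
  ring

theorem antianalyticPoly_eq_zero_iff {N : ℕ} {x : Fin (N + 1) → ℂ} :
    antianalyticPoly x = 0 ↔ x = 0 := by
  refine ⟨fun h => ?_, fun h => by simp [antianalyticPoly, h]⟩
  have hli : LinearIndependent ℂ (fun n : ℤ => (fourier n : C(Torus, ℂ))) :=
    LinearIndependent.of_comp (ContinuousMap.toLp 2 torusMeasure ℂ).toLinearMap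
      (orthonormal_fourier (T := 2 * Real.pi)).linearIndependent
  have hinj : Function.Injective (fun l : Fin (N + 1) => -(l : ℤ)) := fun a b hab => by
    simpa [Fin.ext_iff] using hab
  ext l
  exact Fintype.linearIndependent_iff.mp (hli.comp _ hinj) x h l

theorem integrable_mul_norm_sq {h : Torus → ℝ} (hh : Integrable h torusMeasure)
    (p : C(Torus, ℂ)) : Integrable (fun θ => h θ * ‖p θ‖ ^ 2) torusMeasure :=
  hh.mul_bdd (c := ‖p‖ ^ 2) (by fun_prop) (ae_of_all _ fun θ => by
    simpa using pow_le_pow_left₀ (norm_nonneg _) (p.norm_coe_le_norm θ) 2)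

open scoped ComplexOrder in
theorem toeplitz_posSemidef_iff {N : ℕ} {h : Torus → ℝ} (hh : Integrable h torusMeasure) :
    (toeplitz N h).PosSemidef ↔
      ∀ x : Fin (N + 1) → ℂ, 0 ≤ ∫ θ, h θ * ‖antianalyticPoly x θ‖ ^ 2 ∂torusMeasure := by
  rw [Matrix.posSemidef_iff_dotProduct_mulVec]
  simp only [toeplitz_isHermitian, true_and, star_dotProduct_toeplitz_mulVec hh,
    Complex.zero_le_real]

open scoped ComplexOrder in
theorem toeplitz_posDef {h : Torus → ℝ} (hh : Integrable h torusMeasure)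
    (hpos : ∀ᵐ θ ∂torusMeasure, 0 < h θ) (N : ℕ) : (toeplitz N h).PosDef := by
  refine Matrix.PosDef.of_dotProduct_mulVec_pos (toeplitz_isHermitian N h) fun x hx => ?_
  rw [star_dotProduct_toeplitz_mulVec hh, Complex.zero_lt_real]
  have h0 : 0 ≤ᵐ[torusMeasure] fun θ => h θ * ‖antianalyticPoly x θ‖ ^ 2 := by
    filter_upwards [hpos] with θ hθ
    simp only [Pi.zero_apply]
    positivity
  refine (integral_nonneg_of_ae h0).lt_of_ne fun heq => hx ?_
  rw [eq_comm, integral_eq_zero_iff_of_nonneg_ae h0 (integrable_mul_norm_sq hh _)] at heq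
  have hae : ⇑(antianalyticPoly x) =ᵐ[torusMeasure] ⇑(0 : C(Torus, ℂ)) := by
    filter_upwards [heq, hpos] with θ h1 h2
    simpa [h2.ne'] using h1
  rw [← antianalyticPoly_eq_zero_iff]
  exact DFunLike.coe_injective
    (Continuous.ae_eq_iff_eq _ (map_continuous _) (map_continuous _) |>.mp hae)

/-- Multiplication by a power of `e^{iθ}` does not change the modulus, so every trigonometric
polynomial has the modulus of an antianalytic one. -/
theorem exists_norm_antianalyticPoly_eq {p : C(Torus, ℂ)}
    (hp : p ∈ Submodule.span ℂ (Set.range (fourier (T := 2 * Real.pi)))) :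
    ∀ᶠ N : ℕ in atTop, ∃ x : Fin (N + 1) → ℂ, ∀ θ, ‖antianalyticPoly x θ‖ = ‖p θ‖ := by
  obtain ⟨c, rfl⟩ := Finsupp.mem_span_range_iff_exists_finsupp.mp hp
  -- All frequencies lie in `[-m, m]`; the shift by `m` moves them to `[-2m, 0]`.
  set m := c.support.sup Int.natAbs
  have hm : ∀ k ∈ c.support, k.natAbs ≤ m := fun k hk => Finset.le_sup (f := Int.natAbs) hk
  filter_upwards [eventually_ge_atTop (2 * m)] with N hN
  refine ⟨fun l => c ((m : ℤ) - l), fun θ => ?_⟩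
  have hinj : Function.Injective (fun l : Fin (N + 1) => (m : ℤ) - l) := fun a b hab => by
    simpa [Fin.ext_iff] using hab
  have hsum : (c.sum fun i a => a • fourier (T := 2 * Real.pi) i) =
      ∑ l : Fin (N + 1), c ((m : ℤ) - l) • fourier ((m : ℤ) - l) := by
    rw [Finsupp.sum, ← Finset.sum_image (s := Finset.univ) (g := fun l : Fin (N + 1) => (m : ℤ) - l)
      (f := fun k => c k • fourier (T := 2 * Real.pi) k) hinj.injOn]
    refine Finset.sum_subset (fun k hk => ?_) fun k _ hk => ?_
    · have := hm k hk
      refine Finset.mem_image.mpr ⟨⟨(m - k).toNat, by omega⟩, Finset.mem_univ _, ?_⟩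
      simp only
      omega
    · rw [Finsupp.notMem_support_iff.mp hk, zero_smul]
  have hmul : (c.sum fun i a => a • fourier (T := 2 * Real.pi) i) θ =
      fourier (m : ℤ) θ * antianalyticPoly (fun l : Fin (N + 1) => c ((m : ℤ) - l)) θ := by
    rw [hsum]
    simp only [antianalyticPoly, ContinuousMap.coe_sum, Finset.sum_apply, ContinuousMap.smul_apply,
      Finset.mul_sum, smul_eq_mul, sub_eq_add_neg, fourier_add]
    refine Finset.sum_congr rfl fun l _ => ?_
    ring
  rw [hmul, norm_mul, fourier_apply, Circle.norm_coe, one_mul]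

theorem continuous_integral_mul_norm_sq {h : Torus → ℝ} (hh : Integrable h torusMeasure) :
    Continuous fun p : C(Torus, ℂ) => ∫ θ, h θ * ‖p θ‖ ^ 2 ∂torusMeasure := by
  refine continuous_iff_continuousAt.mpr fun φ => ?_
  refine tendsto_integral_filter_of_dominated_convergence
    (fun θ => ‖h θ‖ * (‖φ‖ + 1) ^ 2) ?_ ?_ (hh.norm.mul_const _) (ae_of_all _ fun θ => ?_)
  · exact Eventually.of_forall fun p => (integrable_mul_norm_sq hh p).aestronglyMeasurable
  · filter_upwards [Metric.ball_mem_nhds φ one_pos] with p hp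
    refine ae_of_all _ fun θ => ?_
    have h1 : ‖p θ‖ ≤ ‖φ‖ + 1 := by
      refine (p.norm_coe_le_norm θ).trans ?_
      have := norm_le_norm_add_norm_sub' p φ
      rw [mem_ball_iff_norm] at hp
      linarith
    rw [norm_mul, norm_pow, norm_norm]
    gcongr
  · exact ((Continuous.norm (continuous_eval_const θ)).pow 2).const_mul (h θ) |>.tendsto φ

open scoped ComplexOrder in
/-- Otherwise the form `φ ↦ ∫ h |φ|²` would be nonnegative on trigonometric polynomials, hence by
density on all continuous functions, including a bump function supported in `U`. -/
theorem eventually_not_posSemidef_toeplitz {h : Torus → ℝ} (hh : Integrable h torusMeasure)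
    {U : Set Torus} (hU : IsOpen U) (hne : U.Nonempty)
    (hneg : ∀ᵐ θ ∂torusMeasure, θ ∈ U → h θ < 0) :
    ∀ᶠ N : ℕ in atTop, ¬ (toeplitz N h).PosSemidef := by
  by_contra hcon
  rw [not_eventually] at hcon
  simp only [not_not] at hcon
  have hclosed : IsClosed {p : C(Torus, ℂ) | 0 ≤ ∫ θ, h θ * ‖p θ‖ ^ 2 ∂torusMeasure} :=
    isClosed_le continuous_const (continuous_integral_mul_norm_sq hh)
  have hpoly : (Submodule.span ℂ (Set.range (fourier (T := 2 * Real.pi))) : Set C(Torus, ℂ)) ⊆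
      {p : C(Torus, ℂ) | 0 ≤ ∫ θ, h θ * ‖p θ‖ ^ 2 ∂torusMeasure} := by
    intro p hp
    obtain ⟨N, hN, x, hx⟩ := (hcon.and_eventually (exists_norm_antianalyticPoly_eq hp)).exists
    have := (toeplitz_posSemidef_iff hh).mp hN x
    simp only [hx] at this
    exact this
  have hall : ∀ φ : C(Torus, ℂ), 0 ≤ ∫ θ, h θ * ‖φ θ‖ ^ 2 ∂torusMeasure := fun φ => by
    have hφ : φ ∈ (Submodule.span ℂ (Set.range (fourier (T := 2 * Real.pi)))).topologicalClosure :=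
      by rw [span_fourier_closure_eq_top]; exact Submodule.mem_top
    exact hclosed.closure_subset_iff.mpr hpoly hφ
  obtain ⟨θ₀, hθ₀⟩ := hne
  obtain ⟨r, hr, hball⟩ := Metric.isOpen_iff.mp hU θ₀ hθ₀
  let φ : C(Torus, ℂ) := ⟨fun θ => ((max 0 (r - dist θ θ₀) : ℝ) : ℂ), by fun_prop⟩
  have hφ0 : ∀ θ, θ ∉ Metric.ball θ₀ r → φ θ = 0 := fun θ hθ => by
    rw [Metric.mem_ball, not_lt] at hθ
    simp [φ, hθ]
  have hφ1 : ∀ θ ∈ Metric.ball θ₀ r, φ θ ≠ 0 := fun θ hθ => by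
    rw [Metric.mem_ball] at hθ
    simp only [φ, ContinuousMap.coe_mk, ne_eq, Complex.ofReal_eq_zero]
    exact (lt_max_of_lt_right (sub_pos.mpr hθ)).ne'
  have hle : 0 ≤ᵐ[torusMeasure] fun θ => -(h θ * ‖φ θ‖ ^ 2) := by
    filter_upwards [hneg] with θ hθ
    by_cases hb : θ ∈ Metric.ball θ₀ r
    · have := mul_nonneg_of_nonpos_of_nonpos (hθ (hball hb)).le
        (neg_nonpos.mpr (sq_nonneg ‖φ θ‖))
      simpa using this
    · simp [hφ0 θ hb]
  have hzero : ∫ θ, -(h θ * ‖φ θ‖ ^ 2) ∂torusMeasure = 0 :=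
    le_antisymm (by rw [integral_neg]; exact neg_nonpos.mpr (hall φ)) (integral_nonneg_of_ae hle)
  rw [integral_eq_zero_iff_of_nonneg_ae hle (integrable_mul_norm_sq hh φ).neg] at hzero
  have hnull : ∀ᵐ θ ∂torusMeasure, θ ∉ Metric.ball θ₀ r := by
    filter_upwards [hzero, hneg] with θ h1 h2 hb
    simp [(h2 (hball hb)).ne, hφ1 θ hb] at h1
  exact Metric.isOpen_ball.measure_ne_zero torusMeasure ⟨θ₀, Metric.mem_ball_self hr⟩
    (measure_eq_zero_iff_ae_notMem.mpr hnull)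

end

/-! ### The symbols `|1 - χ|^{2α} c` -/

theorem chi_coe (x : ℝ) : chi (x : Torus) = Complex.exp (Complex.I * x) := by
  rw [chi, AddCircle.toCircle_apply_mk, Circle.coe_exp, mul_comm]
  rw [div_self Real.two_pi_pos.ne', one_mul]

theorem continuous_chi : Continuous chi :=
  continuous_subtype_val.comp AddCircle.continuous_toCircle

theorem one_sub_chi_eq_zero_iff {θ : Torus} : 1 - chi θ = 0 ↔ θ = 0 := by
  rw [sub_eq_zero, eq_comm, chi, Circle.coe_eq_one]
  refine ⟨fun h => AddCircle.injective_toCircle Real.two_pi_pos.ne' ?_, fun h => ?_⟩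
  · rw [h, AddCircle.toCircle_zero]
  · rw [h, AddCircle.toCircle_zero]

theorem integrableOn_abs_rpow {r a : ℝ} (hr : -1 < r) (ha : 0 ≤ a) :
    IntegrableOn (fun x : ℝ => |x| ^ r) (Set.Ioc (-a) a) := by
  have h1 : IntervalIntegrable (fun x : ℝ => |x| ^ r) volume 0 a := by
    refine (intervalIntegral.intervalIntegrable_rpow' hr (a := 0) (b := a)).congr ?_
    intro x hx
    rw [Set.uIoc_of_le ha] at hx
    simp only [abs_of_pos hx.1]
  have h2 : IntervalIntegrable (fun x : ℝ => |x| ^ r) volume (-a) 0 := by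
    simpa using ((IntervalIntegrable.iff_comp_neg).mp h1).symm
  exact (intervalIntegrable_iff_integrableOn_Ioc_of_le (by linarith)).mp (h2.trans h1)

/-- Jordan's inequality applied to `|1 - e^{ix}| = 2 |sin (x / 2)|`. -/
theorem mul_abs_le_norm_one_sub_chi {x : ℝ} (hx : |x| ≤ Real.pi) :
    2 / Real.pi * |x| ≤ ‖1 - chi (x : Torus)‖ := by
  rw [chi_coe, norm_sub_rev, Complex.norm_exp_I_mul_ofReal_sub_one, Real.norm_eq_abs, abs_mul]
  have h := Real.mul_abs_le_abs_sin (x := x / 2) (by rw [abs_div, abs_two]; linarith)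
  rw [abs_div, abs_two] at h
  rw [abs_two]
  linarith

theorem integrable_norm_one_sub_chi_rpow {r : ℝ} (hr : -1 < r) (hr0 : r ≤ 0) :
    Integrable (fun θ => ‖1 - chi θ‖ ^ r) torusMeasure := by
  have hmeas : Measurable fun θ => ‖1 - chi θ‖ ^ r :=
    (measurable_const.sub continuous_chi.measurable).norm.pow_const r
  have hvol : Integrable (fun θ => ‖1 - chi θ‖ ^ r) (volume : Measure Torus) := by
    rw [← (AddCircle.measurePreserving_mk (2 * Real.pi) (-Real.pi)).integrable_comp
      hmeas.aestronglyMeasurable]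
    rw [show -Real.pi + 2 * Real.pi = Real.pi by ring]
    refine Integrable.mono' (((integrableOn_abs_rpow hr Real.pi_pos.le).const_mul
      ((2 / Real.pi) ^ r))) (hmeas.comp (AddCircle.measurable_mk')).aestronglyMeasurable ?_
    have h0 : ∀ᵐ x : ℝ ∂volume.restrict (Set.Ioc (-Real.pi) Real.pi), x ≠ 0 :=
      ae_restrict_of_ae (Measure.ae_ne volume 0)
    filter_upwards [h0, ae_restrict_mem measurableSet_Ioc] with x hx0 hx
    rw [Function.comp_apply, Real.norm_of_nonneg (by positivity),
      ← Real.mul_rpow (by positivity) (abs_nonneg x)]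
    have hpos : 0 < 2 / Real.pi * |x| := mul_pos (by positivity) (abs_pos.mpr hx0)
    exact Real.rpow_le_rpow_of_nonpos hpos
      (mul_abs_le_norm_one_sub_chi (abs_le.mpr ⟨hx.1.le, hx.2⟩)) hr0
  rw [AddCircle.volume_eq_smul_haarAddCircle] at hvol
  exact (integrable_smul_measure (by simp [Real.pi_pos]) ENNReal.ofReal_ne_top).mp hvol

theorem integrable_symbol_of_nonneg {α : ℝ} (hα : 0 ≤ α) {c : Torus → ℝ} (hc : Continuous c) :
    Integrable (symbol α c) torusMeasure := by
  have : Continuous (symbol α c) :=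
    ((continuous_const.sub continuous_chi).norm.rpow_const fun _ => Or.inr (by linarith)).mul hc
  exact this.integrable_of_hasCompactSupport (HasCompactSupport.of_compactSpace _)

theorem integrable_symbol_of_nonpos {α : ℝ} (hα : -(1 / 2) < α) (hα0 : α ≤ 0) {c : Torus → ℝ}
    (hc : Continuous c) : Integrable (symbol α c) torusMeasure := by
  obtain ⟨K, hK⟩ := isCompact_univ.exists_bound_of_continuousOn hc.continuousOn
  exact (integrable_norm_one_sub_chi_rpow (by linarith) (by linarith)).mul_bdd (c := K)
    hc.aestronglyMeasurable (ae_of_all _ fun θ => hK θ (Set.mem_univ θ))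

theorem symbol_nonneg (α : ℝ) {c : Torus → ℝ} (hc : ∀ θ, 0 < c θ) (θ : Torus) :
    0 ≤ symbol α c θ :=
  mul_nonneg (by positivity) (hc θ).le

theorem ae_symbol_pos (α : ℝ) {c : Torus → ℝ} (hc : ∀ θ, 0 < c θ) :
    ∀ᵐ θ ∂torusMeasure, 0 < symbol α c θ := by
  have h : ∀ᵐ θ ∂torusMeasure, θ ≠ 0 := by
    have hv : ∀ᵐ θ ∂(volume : Measure Torus), θ ≠ 0 := by
      rw [ae_iff]
      simpa using AddCircle.volume_closedBall (2 * Real.pi) (x := 0) 0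
    rw [AddCircle.volume_eq_smul_haarAddCircle] at hv
    exact (Measure.ae_ennreal_smul_measure_iff (by simp [Real.pi_pos])).mp hv
  filter_upwards [h] with θ hθ
  exact mul_pos (Real.rpow_pos_of_pos (norm_pos_iff.mpr (one_sub_chi_eq_zero_iff.not.mpr hθ)) _)
    (hc θ)

/-- The quotient of the symbols is continuous: the junk value `0 / 0 = 0` at `θ = 0` is
its limit there. -/
theorem continuous_symbol_div_symbol {α₁ α₂ : ℝ} (hα₁ : 0 < α₁) (hα₂ : α₂ < 0)
    {c₁ c₂ : Torus → ℝ} (hc₁ : Continuous c₁) (hc₂ : Continuous c₂) (hpos : ∀ θ, 0 < c₂ θ) :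
    Continuous fun θ => symbol α₁ c₁ θ / symbol α₂ c₂ θ := by
  have h : (fun θ => symbol α₁ c₁ θ / symbol α₂ c₂ θ) =
      fun θ => ‖1 - chi θ‖ ^ (2 * α₁ - 2 * α₂) * (c₁ θ / c₂ θ) := by
    ext θ
    simp only [symbol]
    rcases (norm_nonneg (1 - chi θ)).eq_or_lt with h0 | h0
    · rw [← h0, Real.zero_rpow (by linarith), Real.zero_rpow (by linarith),
        zero_mul, zero_div, Real.zero_rpow (by linarith), zero_mul]
    · rw [Real.rpow_sub h0, mul_div_mul_comm]
  rw [h]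
  exact ((continuous_const.sub continuous_chi).norm.rpow_const fun _ => Or.inr (by linarith)).mul
    (hc₁.div hc₂ fun θ => (hpos θ).ne')

theorem eLpNorm_top_eq_of_isMax {g : Torus → ℝ} (hg : Continuous g) (hg0 : ∀ θ, 0 ≤ g θ)
    {θ₀ : Torus} (hmax : ∀ θ, g θ ≤ g θ₀) :
    eLpNorm g ⊤ torusMeasure = ENNReal.ofReal (g θ₀) := by
  rw [eLpNorm_exponent_top]
  refine le_antisymm (eLpNormEssSup_le_of_ae_bound (ae_of_all _ fun θ => ?_))
    (not_lt.mp fun hlt => ?_)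
  · rw [Real.norm_of_nonneg (hg0 θ)]
    exact hmax θ
  · have hopen : IsOpen {θ | eLpNormEssSup g torusMeasure < ‖g θ‖ₑ} :=
      isOpen_lt continuous_const hg.enorm
    refine hopen.measure_ne_zero torusMeasure ⟨θ₀, ?_⟩ meas_eLpNormEssSup_lt
    rw [Set.mem_ofPred_eq, Real.enorm_of_nonneg (hg0 θ₀)]
    exact hlt

/-! ### Eigenvalues of a quotient of Toeplitz matrices -/

open scoped ComplexOrder in
theorem isUnit_det_toeplitz {f : Torus → ℝ} (hf : Integrable f torusMeasure)
    (hpos : ∀ᵐ θ ∂torusMeasure, 0 < f θ) (N : ℕ) : IsUnit (toeplitz N f).det :=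
  (Matrix.isUnit_iff_isUnit_det _).mp (toeplitz_posDef hf hpos N).isUnit

open scoped ComplexOrder in
/-- For integrable symbols `f₂ > 0` and `f₁ = g f₂` with `g` continuous, the extreme eigenvalues of
`T_N(f₁) T_N(f₂)⁻¹` converge to the minimum and the maximum of `g`. Their position with respect to
a level `t` is read off from the sign of the Toeplitz matrix of `(g - t) f₂`. -/
theorem exists_isOrderedSpectrum_toeplitz_tendsto {f₁ f₂ g : Torus → ℝ}
    (hf₁ : Integrable f₁ torusMeasure) (hf₂ : Integrable f₂ torusMeasure)
    (hpos : ∀ᵐ θ ∂torusMeasure, 0 < f₂ θ) (hg : Continuous g)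
    (hfg : ∀ᵐ θ ∂torusMeasure, f₁ θ = g θ * f₂ θ) {θmin θmax : Torus}
    (hmin : ∀ θ, g θmin ≤ g θ) (hmax : ∀ θ, g θ ≤ g θmax) :
    ∃ μ : (N : ℕ) → Fin (N + 1) → ℝ,
      (∀ N : ℕ, IsOrderedSpectrum (toeplitz N f₁ * (toeplitz N f₂)⁻¹) (μ N)) ∧
      Tendsto (fun N : ℕ => μ N 0) atTop (𝓝 (g θmin)) ∧
      Tendsto (fun N : ℕ => μ N (Fin.last N)) atTop (𝓝 (g θmax)) := by
  choose μ hμ hμ0 hμ1 using fun N =>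
    exists_isOrderedSpectrum_mul_inv (toeplitz_isHermitian N f₁) (toeplitz_posDef hf₂ hpos N)
  have hlow : ∀ N t, t ≤ μ N 0 ↔ (toeplitz N fun θ => 1 * f₁ θ - t * f₂ θ).PosSemidef :=
    fun N t => by rw [hμ0, toeplitz_sub_smul N hf₁ hf₂]; simp
  have hup : ∀ N t, μ N (Fin.last N) ≤ t ↔
      (toeplitz N fun θ => t * f₂ θ - 1 * f₁ θ).PosSemidef :=
    fun N t => by rw [hμ1, toeplitz_sub_smul N hf₂ hf₁]; simp
  have hI₁ : ∀ t, Integrable (fun θ => 1 * f₁ θ - t * f₂ θ) torusMeasure :=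
    fun t => (hf₁.const_mul 1).sub (hf₂.const_mul t)
  have hI₂ : ∀ t, Integrable (fun θ => t * f₂ θ - 1 * f₁ θ) torusMeasure :=
    fun t => (hf₂.const_mul t).sub (hf₁.const_mul 1)
  refine ⟨μ, hμ, tendsto_order.mpr ⟨fun t ht => Eventually.of_forall fun N => ht.trans_le ?_,
    fun t ht => ?_⟩, tendsto_order.mpr ⟨fun t ht => ?_,
      fun t ht => Eventually.of_forall fun N => lt_of_le_of_lt ?_ ht⟩⟩
  · rw [hlow, toeplitz_posSemidef_iff (hI₁ _)]
    refine fun x => integral_nonneg_of_ae ?_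
    filter_upwards [hpos, hfg] with θ h2 h1
    rw [h1, one_mul, ← sub_mul]
    have := sub_nonneg.mpr (hmin θ)
    simp only [Pi.zero_apply]
    positivity
  · have h := eventually_not_posSemidef_toeplitz (hI₁ t) (isOpen_lt hg continuous_const)
      ⟨θmin, ht⟩ (by
        filter_upwards [hpos, hfg] with θ h2 h1 hθ
        rw [h1, one_mul, ← sub_mul]
        exact mul_neg_of_neg_of_pos (sub_neg.mpr hθ) h2)
    filter_upwards [h] with N hN
    rwa [← hlow, not_le] at hN
  · have h := eventually_not_posSemidef_toeplitz (hI₂ t) (isOpen_lt continuous_const hg)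
      ⟨θmax, ht⟩ (by
        filter_upwards [hpos, hfg] with θ h2 h1 hθ
        rw [h1, one_mul, ← sub_mul]
        exact mul_neg_of_neg_of_pos (sub_neg.mpr hθ) h2)
    filter_upwards [h] with N hN
    rwa [← hup, not_le] at hN
  · rw [hup, toeplitz_posSemidef_iff (hI₂ _)]
    refine fun x => integral_nonneg_of_ae ?_
    filter_upwards [hpos, hfg] with θ h2 h1
    rw [h1, one_mul, ← sub_mul]
    have := sub_nonneg.mpr (hmax θ)
    simp only [Pi.zero_apply]
    positivity

theorem mainTheorem5 (α₁ α₂ : ℝ) (hα₁ : 0 < α₁) (hα₁' : α₁ < 1 / 2)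
    (hα₂ : α₂ < 0) (hα₂' : -(1 / 2) < α₂)
    (c₁ c₂ : Torus → ℝ) (hc₁ : IsRegularFactor c₁) (hc₂ : IsRegularFactor c₂)
    (heven₁ : Function.Even (symbol α₁ c₁)) (heven₂ : Function.Even (symbol α₂ c₂)) :
    (∀ N : ℕ, IsUnit (toeplitz N (symbol α₂ c₂)).det) ∧
    MemLp (fun θ => symbol α₁ c₁ θ / symbol α₂ c₂ θ) ⊤ torusMeasure ∧
    ∃ μ : (N : ℕ) → Fin (N + 1) → ℝ,
      (∀ N : ℕ, IsOrderedSpectrum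
        (toeplitz N (symbol α₁ c₁) * (toeplitz N (symbol α₂ c₂))⁻¹) (μ N)) ∧
      Tendsto (fun N : ℕ => μ N 0) atTop (𝓝 0) ∧
      Tendsto (fun N : ℕ => μ N (Fin.last N)) atTop
        (𝓝 (eLpNorm (fun θ => symbol α₁ c₁ θ / symbol α₂ c₂ θ) ⊤ torusMeasure).toReal) := by
  have hint₁ := integrable_symbol_of_nonneg hα₁.le hc₁.continuous
  have hint₂ := integrable_symbol_of_nonpos hα₂' hα₂.le hc₂.continuous
  have hpos₂ := ae_symbol_pos α₂ hc₂.pos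
  set g : Torus → ℝ := fun θ => symbol α₁ c₁ θ / symbol α₂ c₂ θ with hg
  have hgc : Continuous g :=
    continuous_symbol_div_symbol hα₁ hα₂ hc₁.continuous hc₂.continuous hc₂.pos
  have hg0 : ∀ θ, 0 ≤ g θ := fun θ =>
    div_nonneg (symbol_nonneg α₁ hc₁.pos θ) (symbol_nonneg α₂ hc₂.pos θ)
  -- The factor `|1 - χ|^{2α₁}` of the numerator vanishes at `0`.
  have hgzero : g 0 = 0 := by
    simp [hg, symbol, one_sub_chi_eq_zero_iff.mpr rfl, Real.zero_rpow, hα₁.ne']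
  have hfg : ∀ᵐ θ ∂torusMeasure, symbol α₁ c₁ θ = g θ * symbol α₂ c₂ θ := by
    filter_upwards [hpos₂] with θ hθ
    rw [hg, div_mul_cancel₀ _ hθ.ne']
  obtain ⟨θ₀, -, hθ₀⟩ := isCompact_univ.exists_isMaxOn Set.univ_nonempty hgc.continuousOn
  have hmax : ∀ θ, g θ ≤ g θ₀ := fun θ => hθ₀ (Set.mem_univ θ)
  obtain ⟨μ, hμ, hlow, hup⟩ := exists_isOrderedSpectrum_toeplitz_tendsto hint₁ hint₂ hpos₂ hgc hfg
    (θmin := 0) (fun θ => hgzero ▸ hg0 θ) hmax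
  refine ⟨isUnit_det_toeplitz hint₂ hpos₂, ?_, μ, hμ, hgzero ▸ hlow, ?_⟩
  · refine memLp_top_of_bound hgc.aestronglyMeasurable (g θ₀) (ae_of_all _ fun θ => ?_)
    rw [Real.norm_of_nonneg (hg0 θ)]
    exact hmax θ
  · rwa [eLpNorm_top_eq_of_isMax hgc hg0 hmax, ENNReal.toReal_ofReal (hg0 θ₀)]
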